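/- For an irrational real number $\alpha$ and $t\ge 1$ let $\psi_\alpha(t)=\min_{1\le q\le t}\|q\alpha\|$, where $q$ runs over integers and $\|\cdot\|$ denotes the distance to the nearest integer, and let $I_\alpha(t)=\int_1^t\psi_\alpha(\xi)\,d\xi$. Say that a function $f$ changes its sign infinitely often as $t\to+\infty$ if it takes both positive and negative values at arbitrarily large $t$. (1) For $\tau=\frac{\sqrt5-1}{2}$ one has $$\lim_{t\to+\infty}\frac{I_\tau(t)}{\ln t}=\left(\frac12-\frac{\sqrt5}{10}\right)\Big/\ln\left(\frac{1+\sqrt5}{2}\right).$$ (2) If $\alpha,\beta$ are irrational, the limits $a=\lim_{t\to+\infty} I_\alpha(t)/\ln t$ and $b=\lim_{t\to+\infty} I_\beta(t)/\ln t$ exist, and $a>b$, then $I_\alpha(t)-I_\beta(t)\to+\infty$ as $t\to+\infty$. (3) There exist real numbers $\alpha,\beta$, algebraically independent over $\mathbb{Q}$, such that the limits $\lim_{t\to+\infty} I_\alpha(t)/\ln t$ and $\lim_{t\to+\infty} I_\beta(t)/\ln t$ exist and are different, $I_\alpha(t)-I_\beta(t)\to+\infty$ as $t\to+\infty$, and $I_\alpha(t)-I_\beta(t)$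 does not change its sign infinitely often as $t\to+\infty$. (4) Consequently, it is not true that for all irrational $\alpha,\beta$ with $\alpha+\beta\notin\mathbb{Z}$ and $\alpha-\beta\notin\mathbb{Z}$ the difference $I_\alpha(t)-I_\beta(t)$ changes its sign infinitely often as $t\to+\infty$. -/

import Mathlib

open Filter Topology

/-- The distance `‖x‖` from the real number `x` to the nearest integer. -/
noncomputable def distNearestInt (x : ℝ) : ℝ := |x - (round x : ℝ)|

/-- The finite set of values `‖q α‖`, where `q` runs over the integers with `1 ≤ q ≤ t`. -/
def approxValues (α t : ℝ) : Set ℝ :=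
  {x | ∃ q : ℤ, 1 ≤ q ∧ (q : ℝ) ≤ t ∧ x = distNearestInt (q * α)}

/-- The irrationality measure function `ψ_α(t) = min_{1 ≤ q ≤ t} ‖q α‖` (for `t ≥ 1`). -/
noncomputable def irrMeasure (α t : ℝ) : ℝ := sInf (approxValues α t)

/-- The integral `I_α(t) = ∫_1^t ψ_α(ξ) dξ`. -/
noncomputable def irrIntegral (α t : ℝ) : ℝ := ∫ ξ in (1 : ℝ)..t, irrMeasure α ξ

/-- `f` changes its sign infinitely often as `t → +∞`: it takes positive values and negative
values at arbitrarily large arguments. -/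
def ChangesSignInfinitelyOften (f : ℝ → ℝ) : Prop :=
  (∃ᶠ t in atTop, 0 < f t) ∧ (∃ᶠ t in atTop, f t < 0)

/-- For `t ≥ 1` the infimum defining `ψ_α(t)` is a minimum. -/
theorem irrMeasure_isLeast (α : ℝ) {t : ℝ} (ht : 1 ≤ t) :
    IsLeast (approxValues α t) (irrMeasure α t) := by
  have hne : (approxValues α t).Nonempty := ⟨_, 1, le_refl _, by simpa using ht, rfl⟩
  have hfin : (approxValues α t).Finite := by
    refine ((Set.finite_Icc (1 : ℤ) ⌊t⌋).image
      (fun q : ℤ => distNearestInt (q * α))).subset ?_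
    rintro x ⟨q, h1, h2, rfl⟩
    exact ⟨q, ⟨h1, Int.le_floor.2 h2⟩, rfl⟩
  exact ⟨hne.csInf_mem hfin, fun x hx => csInf_le hfin.bddBelow hx⟩

/-- `ψ_α` is integrable on every interval `[1, t]`, so `I_α(t)` is a genuine integral. -/
theorem irrMeasure_intervalIntegrable (α : ℝ) {t : ℝ} (ht : 1 ≤ t) :
    IntervalIntegrable (irrMeasure α) MeasureTheory.volume 1 t := by
  apply AntitoneOn.intervalIntegrable
  rw [Set.uIcc_of_le ht]
  intro x hx y hy hxy
  obtain ⟨q, h1, h2, h3⟩ := (irrMeasure_isLeast α hx.1).1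
  exact (irrMeasure_isLeast α hy.1).2 ⟨q, h1, h2.trans hxy, h3⟩

/-! Let `q_n` be the convergent denominators of `α = θ 0` and `r n = q_n / q_(n+1)`. By the law of
best approximation `ψ_α` is constant on `[q_n, q_(n+1))`, equal to `|q_n α - p_n| = θ 0 ⋯ θ n`. This
interval therefore contributes `(1 - r n) / (1 + r n * θ (n+1))` to `I_α`, while `log q_N` is the
sum of the `-log (r n)`. The growth of `I_α(t) / log t` is thus read off from two sums over the
digits (`irrIntegral_cfDen`, `log_cfDen`).

If the digits are 1 or 2 and the 2s have density zero, `r n` and `θ n` are on average close to `τ`,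
and the limit is the positive golden value. If `q_n ≥ 2^(n²)`, then `I_α(q_n) ≤ n` is negligible
against `log q_n`, and the limit is 0. Each pattern is realised by uncountably many numbers, so a
cardinality argument yields `β` of the second kind transcendental over `ℚ`, then `α` of the first
kind transcendental over `ℚ[β]`.

Limits `a > b` force `I_α - I_β` to grow like `(a - b) log t`, which rules out infinitely many sign
changes; algebraic independence rules out `α ± β ∈ ℤ`. -/

/-- The denominators of the convergents of `[0; a 0, a 1, …]`. -/
def cfDen (a : ℕ → ℕ) : ℕ → ℤ
  | 0 => 1
  | 1 => a 0
  | n + 2 => a (n + 1) * cfDen a (n + 1) + cfDen a n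

/-- The numerators of the convergents of `[0; a 0, a 1, …]`. -/
def cfNum (a : ℕ → ℕ) : ℕ → ℤ
  | 0 => 0
  | 1 => 1
  | n + 2 => a (n + 1) * cfNum a (n + 1) + cfNum a n

theorem cfDen_mul_cfNum_sub (a : ℕ → ℕ) (n : ℕ) :
    cfDen a n * cfNum a (n + 1) - cfNum a n * cfDen a (n + 1) = (-1) ^ n := by
  induction n with
  | zero => simp [cfDen, cfNum]
  | succ n ih =>
    rw [pow_succ, ← ih]
    simp only [cfDen, cfNum]
    ring

/-- `θ` is the orbit under the Gauss map of a number with partial quotients `a`: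
`θ n = [0; a n, a (n + 1), …]`. -/
structure GaussExpansion (a : ℕ → ℕ) (θ : ℕ → ℝ) : Prop where
  pos : ∀ n, 0 < θ n
  lt_one : ∀ n, θ n < 1
  mul_eq : ∀ n, θ n * (a n + θ (n + 1)) = 1

theorem distNearestInt_nonneg (x : ℝ) : 0 ≤ distNearestInt x := abs_nonneg _

theorem distNearestInt_le (x : ℝ) (p : ℤ) : distNearestInt x ≤ |x - p| := round_le x p

theorem irrMeasure_nonneg (α : ℝ) {t : ℝ} (ht : 1 ≤ t) : 0 ≤ irrMeasure α t := by
  obtain ⟨q, -, -, h⟩ := (irrMeasure_isLeast α ht).1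
  rw [h]
  exact distNearestInt_nonneg _

theorem irrIntegral_mono (α : ℝ) {s t : ℝ} (hs : 1 ≤ s) (hst : s ≤ t) :
    irrIntegral α s ≤ irrIntegral α t :=
  intervalIntegral.integral_mono_interval le_rfl hs hst
    (MeasureTheory.ae_restrict_of_forall_mem measurableSet_Ioc
      fun _ hx => irrMeasure_nonneg α hx.1.le)
    (irrMeasure_intervalIntegrable α (hs.trans hst))

theorem irrIntegral_nonneg (α : ℝ) {t : ℝ} (ht : 1 ≤ t) : 0 ≤ irrIntegral α t := by
  simpa [irrIntegral] using irrIntegral_mono α le_rfl ht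

/-! ### Convergents, best approximation and the values of `ψ_α` -/

namespace GaussExpansion

variable {a : ℕ → ℕ} {θ : ℕ → ℝ}

theorem one_le_digit (h : GaussExpansion a θ) (n : ℕ) : 1 ≤ a n := by
  by_contra hn
  have h0 : a n = 0 := by omega
  have h1 := h.mul_eq n
  have := h.pos n
  have := h.lt_one n
  have := h.pos (n + 1)
  have := h.lt_one (n + 1)
  simp only [h0, Nat.cast_zero, zero_add] at h1
  nlinarith

theorem cfDen_pos (h : GaussExpansion a θ) (n : ℕ) : 0 < cfDen a n := by
  induction n using Nat.twoStepInduction with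
  | zero => simp [cfDen]
  | one =>
    simp only [cfDen]
    exact_mod_cast h.one_le_digit 0
  | more n h1 h2 => simp only [cfDen]; positivity

theorem cfDen_le_succ (h : GaussExpansion a θ) (n : ℕ) : cfDen a n ≤ cfDen a (n + 1) := by
  cases n with
  | zero => simpa [cfDen] using h.one_le_digit 0
  | succ n =>
    have h1 : (1 : ℤ) ≤ a (n + 1) := by exact_mod_cast h.one_le_digit (n + 1)
    have := h.cfDen_pos (n + 1)
    have := h.cfDen_pos n
    simp only [cfDen]
    nlinarith

theorem cfDen_mono (h : GaussExpansion a θ) : Monotone (cfDen a) :=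
  monotone_nat_of_le_succ h.cfDen_le_succ

theorem one_le_cfDen (h : GaussExpansion a θ) (n : ℕ) : (1 : ℝ) ≤ cfDen a n := by
  exact_mod_cast h.cfDen_pos n

theorem le_cfDen (h : GaussExpansion a θ) (n : ℕ) : (n : ℤ) ≤ cfDen a n := by
  induction n using Nat.twoStepInduction with
  | zero => simp [cfDen]
  | one => simpa [cfDen] using h.one_le_digit 0
  | more n h1 h2 =>
    have h3 : (1 : ℤ) ≤ a (n + 1) := by exact_mod_cast h.one_le_digit (n + 1)
    have := h.cfDen_pos (n + 1)
    have := h.cfDen_pos n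
    simp only [cfDen]
    push_cast at h2 ⊢
    nlinarith

theorem tendsto_cfDen (h : GaussExpansion a θ) :
    Tendsto (fun n => (cfDen a n : ℝ)) atTop atTop :=
  tendsto_atTop_mono (fun n => by exact_mod_cast h.le_cfDen n) tendsto_natCast_atTop_atTop

theorem prod_pos (h : GaussExpansion a θ) (n : ℕ) : 0 < ∏ i ∈ Finset.range n, θ i :=
  Finset.prod_pos fun i _ => h.pos i

theorem cfDen_mul_sub_cfNum (h : GaussExpansion a θ) (n : ℕ) :
    cfDen a n * θ 0 - cfNum a n = (-1) ^ n * ∏ i ∈ Finset.range (n + 1), θ i := by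
  induction n using Nat.twoStepInduction with
  | zero => simp [cfDen, cfNum]
  | one =>
    have := h.mul_eq 0
    simp only [cfDen, cfNum, Finset.prod_range_succ, Finset.prod_range_zero, Int.cast_natCast,
      Int.cast_one]
    linear_combination this
  | more n h1 h2 =>
    have := h.mul_eq (n + 1)
    rw [Finset.prod_range_succ] at h2
    simp only [cfDen, cfNum, Finset.prod_range_succ _ (n + 2), Finset.prod_range_succ _ (n + 1)]
    push_cast
    rw [pow_succ] at h2
    linear_combination a (n + 1) * h2 + h1 -
      (-1) ^ n * (∏ i ∈ Finset.range (n + 1), θ i) * this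

theorem prod_mul_cfDen (h : GaussExpansion a θ) (n : ℕ) :
    (∏ i ∈ Finset.range (n + 1), θ i) * (cfDen a (n + 1) + θ (n + 1) * cfDen a n) = 1 := by
  induction n with
  | zero => simpa [cfDen] using h.mul_eq 0
  | succ n ih =>
    have := h.mul_eq (n + 1)
    rw [Finset.prod_range_succ]
    simp only [cfDen]
    push_cast
    linear_combination ih + (∏ i ∈ Finset.range (n + 1), θ i) * cfDen a (n + 1) * this

theorem abs_cfDen_mul_sub_cfNum (h : GaussExpansion a θ) (n : ℕ) :
    |cfDen a n * θ 0 - cfNum a n| = ∏ i ∈ Finset.range (n + 1), θ i := by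
  rw [h.cfDen_mul_sub_cfNum, abs_mul, abs_pow, abs_neg, abs_one, one_pow, one_mul,
    abs_of_pos (h.prod_pos _)]

/-- The law of best approximation. -/
theorem prod_le_abs_mul_sub (h : GaussExpansion a θ) (n : ℕ) {q : ℤ} (p : ℤ) (hq : 1 ≤ q)
    (hqn : q < cfDen a (n + 1)) :
    ∏ i ∈ Finset.range (n + 1), θ i ≤ |q * θ 0 - p| := by
  -- Two consecutive convergents form a basis of `ℤ²`, the determinant being `±1`; Cramer's rule
  -- gives the coordinates.
  obtain ⟨x, y, hx, hy⟩ : ∃ x y : ℤ, q = x * cfDen a n + y * cfDen a (n + 1) ∧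
      p = x * cfNum a n + y * cfNum a (n + 1) := by
    have hdet := cfDen_mul_cfNum_sub a n
    have hsq : ((-1 : ℤ) ^ n) * (-1) ^ n = 1 := by rw [← mul_pow]; simp
    refine ⟨(-1) ^ n * (q * cfNum a (n + 1) - p * cfDen a (n + 1)),
      (-1) ^ n * (p * cfDen a n - q * cfNum a n), ?_, ?_⟩
    · linear_combination (-q) * hsq - (-1) ^ n * q * hdet
    · linear_combination (-p) * hsq - (-1) ^ n * p * hdet
  have h1 := h.cfDen_pos n
  have h2 := h.cfDen_pos (n + 1)
  have hd := h.prod_pos (n + 1)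
  have hd' := h.prod_pos (n + 1 + 1)
  have e1 := h.cfDen_mul_sub_cfNum n
  have e2 := h.cfDen_mul_sub_cfNum (n + 1)
  have key : |(q : ℝ) * θ 0 - p| = |(x : ℝ) * (∏ i ∈ Finset.range (n + 1), θ i) -
      y * ∏ i ∈ Finset.range (n + 1 + 1), θ i| := by
    have : (q : ℝ) * θ 0 - p = (-1) ^ n * ((x : ℝ) * (∏ i ∈ Finset.range (n + 1), θ i) -
        y * ∏ i ∈ Finset.range (n + 1 + 1), θ i) := by
      rw [hx, hy]
      push_cast
      rw [pow_succ] at e2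
      linear_combination x * e1 + y * e2
    rw [this, abs_mul, abs_pow, abs_neg, abs_one, one_pow, one_mul]
  rw [key]
  set d := ∏ i ∈ Finset.range (n + 1), θ i
  set d' := ∏ i ∈ Finset.range (n + 1 + 1), θ i
  -- Since `0 < q < q_(n+1)`, `x` is nonzero and `y` never has its sign. The errors of consecutive
  -- convergents alternate in sign, so the two terms reinforce each other and the total is at least
  -- `|x| d ≥ d`.
  rcases lt_trichotomy x 0 with hx0 | hx0 | hx0
  · have hy0 : 0 < y := by nlinarith
    have hxr : (x : ℝ) ≤ -1 := by exact_mod_cast (by omega : x ≤ -1)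
    have hyr : (1 : ℝ) ≤ y := by exact_mod_cast hy0
    rw [le_abs]
    right
    nlinarith
  · subst hx0
    have hy0 : 0 < y := by nlinarith
    nlinarith
  · have hy0 : y ≤ 0 := by nlinarith
    have hxr : (1 : ℝ) ≤ x := by exact_mod_cast hx0
    have hyr : (y : ℝ) ≤ 0 := by exact_mod_cast hy0
    rw [le_abs]
    left
    nlinarith

theorem irrMeasure_eq (h : GaussExpansion a θ) (n : ℕ) {t : ℝ} (h1 : cfDen a n ≤ t)
    (h2 : t < cfDen a (n + 1)) :
    irrMeasure (θ 0) t = ∏ i ∈ Finset.range (n + 1), θ i := by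
  have hl := irrMeasure_isLeast (θ 0) ((h.one_le_cfDen n).trans h1)
  apply le_antisymm
  · rw [← h.abs_cfDen_mul_sub_cfNum]
    exact (hl.2 ⟨cfDen a n, h.cfDen_pos n, h1, rfl⟩).trans (distNearestInt_le _ _)
  · obtain ⟨q, hq1, hqt, hq⟩ := hl.1
    rw [hq]
    exact h.prod_le_abs_mul_sub n _ hq1 (by exact_mod_cast hqt.trans_lt h2)

theorem integral_irrMeasure (h : GaussExpansion a θ) (n : ℕ) :
    ∫ ξ in (cfDen a n : ℝ)..cfDen a (n + 1), irrMeasure (θ 0) ξ =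
      (cfDen a (n + 1) - cfDen a n) * ∏ i ∈ Finset.range (n + 1), θ i := by
  have hle : (cfDen a n : ℝ) ≤ cfDen a (n + 1) := by exact_mod_cast h.cfDen_le_succ n
  rw [intervalIntegral.integral_of_le hle, MeasureTheory.integral_Ioc_eq_integral_Ioo,
    MeasureTheory.setIntegral_congr_fun measurableSet_Ioo
      (fun t ht => h.irrMeasure_eq n ht.1.le ht.2)]
  simp [hle]

/-! ### `I_α(q_N)` and `log q_N` as sums over the digits -/

/-- The ratio of consecutive denominators. -/
noncomputable def _root_.cfRatio (a : ℕ → ℕ) (n : ℕ) : ℝ := cfDen a n / cfDen a (n + 1)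

theorem cfRatio_pos (h : GaussExpansion a θ) (n : ℕ) : 0 < cfRatio a n :=
  div_pos (by exact_mod_cast h.cfDen_pos n) (by exact_mod_cast h.cfDen_pos (n + 1))

theorem cfRatio_le_one (h : GaussExpansion a θ) (n : ℕ) : cfRatio a n ≤ 1 :=
  div_le_one_of_le₀ (by exact_mod_cast h.cfDen_le_succ n)
    (by exact_mod_cast (h.cfDen_pos (n + 1)).le)

/-- The ratio is the continued fraction of the digits read backwards, so it obeys the recursion of
`θ` with time reversed. -/
theorem cfRatio_succ (h : GaussExpansion a θ) (n : ℕ) :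
    cfRatio a (n + 1) = 1 / (a (n + 1) + cfRatio a n) := by
  have h1 : (0 : ℝ) < cfDen a (n + 1) := by exact_mod_cast h.cfDen_pos (n + 1)
  have h2 : (0 : ℝ) < cfDen a (n + 2) := by exact_mod_cast h.cfDen_pos (n + 2)
  have h3 : (cfDen a (n + 2) : ℝ) = a (n + 1) * cfDen a (n + 1) + cfDen a n := by
    simp [cfDen]
  have h4 : (a (n + 1) : ℝ) + cfRatio a n = cfDen a (n + 2) / cfDen a (n + 1) := by
    rw [h3, cfRatio]
    field_simp
  rw [h4, one_div_div, cfRatio]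

/-- The integral of the irrationality measure function between consecutive denominators. -/
theorem integral_irrMeasure_eq_ratio (h : GaussExpansion a θ) (n : ℕ) :
    ∫ ξ in (cfDen a n : ℝ)..cfDen a (n + 1), irrMeasure (θ 0) ξ =
      (1 - cfRatio a n) / (1 + cfRatio a n * θ (n + 1)) := by
  have h1 : (0 : ℝ) < cfDen a (n + 1) := by exact_mod_cast h.cfDen_pos (n + 1)
  have h2 := h.prod_mul_cfDen n
  have h3 := h.cfRatio_pos n
  have h4 := h.pos (n + 1)
  have h5 : (cfDen a n : ℝ) = cfRatio a n * cfDen a (n + 1) := by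
    rw [cfRatio]; field_simp
  rw [h.integral_irrMeasure, eq_div_iff (by positivity)]
  rw [h5] at h2 ⊢
  linear_combination (1 - cfRatio a n) * h2

theorem irrIntegral_cfDen (h : GaussExpansion a θ) (N : ℕ) :
    irrIntegral (θ 0) (cfDen a N) =
      ∑ n ∈ Finset.range N, (1 - cfRatio a n) / (1 + cfRatio a n * θ (n + 1)) := by
  have hI : ∀ n, IntervalIntegrable (irrMeasure (θ 0)) MeasureTheory.volume 1 (cfDen a n) :=
    fun n => irrMeasure_intervalIntegrable _ (h.one_le_cfDen n)
  have := intervalIntegral.sum_integral_adjacent_intervals (f := irrMeasure (θ 0))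
    (μ := MeasureTheory.volume) (a := fun n => (cfDen a n : ℝ)) (n := N)
    (fun k _ => (hI k).symm.trans (hI (k + 1)))
  rw [Finset.sum_congr rfl fun n _ => (h.integral_irrMeasure_eq_ratio n).symm, this]
  simp [irrIntegral, cfDen]

theorem log_cfDen (h : GaussExpansion a θ) (N : ℕ) :
    Real.log (cfDen a N) = ∑ n ∈ Finset.range N, -Real.log (cfRatio a n) := by
  induction N with
  | zero => simp [cfDen]
  | succ N ih =>
    have h1 : (0 : ℝ) < cfDen a N := by exact_mod_cast h.cfDen_pos N
    have h2 : (0 : ℝ) < cfDen a (N + 1) := by exact_mod_cast h.cfDen_pos (N + 1)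
    rw [Finset.sum_range_succ, ← ih, cfRatio, Real.log_div h1.ne' h2.ne']
    ring

/-- The index of the largest denominator not exceeding `t`. -/
theorem exists_index (h : GaussExpansion a θ) :
    ∃ N : ℝ → ℕ, Tendsto N atTop atTop ∧
      ∀ t, 1 ≤ t → (cfDen a (N t) : ℝ) ≤ t ∧ t ≤ cfDen a (N t + 1) := by
  have key : ∀ t : ℝ, ∃ N : ℕ, 1 ≤ t → (cfDen a N : ℝ) ≤ t ∧ t < cfDen a (N + 1) := by
    intro t
    by_cases ht : 1 ≤ t
    · have hex : ∃ n, t < cfDen a n := (h.tendsto_cfDen.eventually_gt_atTop t).exists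
      classical
      obtain ⟨m, hm⟩ : ∃ m, Nat.find hex = m + 1 := by
        refine Nat.exists_eq_succ_of_ne_zero fun h0 => ?_
        have := Nat.find_spec hex
        rw [h0] at this
        simp only [cfDen, Int.cast_one] at this
        linarith
      refine ⟨m, fun _ => ⟨not_lt.1 (Nat.find_min hex (by omega)), ?_⟩⟩
      rw [← hm]
      exact Nat.find_spec hex
    · exact ⟨0, fun h => absurd h ht⟩
  choose N hN using key
  refine ⟨N, ?_, fun t ht => ⟨(hN t ht).1, (hN t ht).2.le⟩⟩
  rw [tendsto_atTop]
  intro M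
  filter_upwards [eventually_ge_atTop (cfDen a M : ℝ)] with t ht
  have h1 := (hN t ((h.one_le_cfDen M).trans ht)).2
  have h2 : cfDen a M < cfDen a (N t + 1) := by exact_mod_cast ht.trans_lt h1
  have := h.cfDen_mono.reflect_lt h2
  omega

end GaussExpansion

/-! ### From denominators to all real `t` -/

namespace GaussExpansion

variable {a : ℕ → ℕ} {θ : ℕ → ℝ}

/-- Both `I_α` and `log` are monotone, so for `q_n ≤ t ≤ q_(n+1)` the quotient at `t` lies between
these two mixed quotients. -/
theorem tendsto_irrIntegral_div_log (h : GaussExpansion a θ) {L : ℝ}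
    (hlo : Tendsto (fun n => irrIntegral (θ 0) (cfDen a n) / Real.log (cfDen a (n + 1)))
      atTop (𝓝 L))
    (hup : Tendsto (fun n => irrIntegral (θ 0) (cfDen a (n + 1)) / Real.log (cfDen a n))
      atTop (𝓝 L)) :
    Tendsto (fun t : ℝ => irrIntegral (θ 0) t / Real.log t) atTop (𝓝 L) := by
  obtain ⟨N, hN, hNt⟩ := h.exists_index
  have hgt : ∀ᶠ t in atTop, (1 : ℝ) < cfDen a (N t) :=
    hN.eventually (h.tendsto_cfDen.eventually_gt_atTop 1)
  refine tendsto_of_tendsto_of_tendsto_of_le_of_le' (hlo.comp hN) (hup.comp hN) ?_ ?_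
  · filter_upwards [hgt, eventually_gt_atTop 1] with t h1 ht
    obtain ⟨h2, h3⟩ := hNt t ht.le
    exact div_le_div₀ (irrIntegral_nonneg _ ht.le) (irrIntegral_mono _ h1.le h2)
      (Real.log_pos ht) (Real.log_le_log (by linarith) h3)
  · filter_upwards [hgt, eventually_gt_atTop 1] with t h1 ht
    obtain ⟨h2, h3⟩ := hNt t ht.le
    exact div_le_div₀ (irrIntegral_nonneg _ (ht.le.trans h3)) (irrIntegral_mono _ ht.le h3)
      (Real.log_pos h1) (Real.log_le_log (by linarith) h2)

theorem tendsto_irrIntegral_div_log_of_tendsto_div (h : GaussExpansion a θ) {c l : ℝ}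
    (hl : l ≠ 0) (hI : Tendsto (fun n : ℕ => irrIntegral (θ 0) (cfDen a n) / n) atTop (𝓝 c))
    (hlog : Tendsto (fun n : ℕ => Real.log (cfDen a n) / n) atTop (𝓝 l)) :
    Tendsto (fun t : ℝ => irrIntegral (θ 0) t / Real.log t) atTop (𝓝 (c / l)) := by
  -- This absorbs the index shift between numerator and denominator in the mixed quotients.
  have h1 : Tendsto (fun n : ℕ => ((n + 1 : ℕ) : ℝ) / n) atTop (𝓝 1) := by
    have := (tendsto_one_div_atTop_nhds_zero_nat (𝕜 := ℝ)).const_add 1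
    rw [add_zero] at this
    refine this.congr' ?_
    filter_upwards [eventually_gt_atTop 0] with n hn
    have : (0 : ℝ) < n := by exact_mod_cast hn
    push_cast
    field_simp
  have hI' := (tendsto_add_atTop_iff_nat 1).2 hI
  have hlog' := (tendsto_add_atTop_iff_nat 1).2 hlog
  apply h.tendsto_irrIntegral_div_log
  · have := hI.div (hlog'.mul h1) (by simpa using hl)
    rw [mul_one] at this
    refine this.congr' ?_
    filter_upwards [eventually_gt_atTop 0] with n hn
    have : (0 : ℝ) < n := by exact_mod_cast hn
    have : (0 : ℝ) < (n + 1 : ℕ) := by positivity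
    simp only [Pi.div_apply]
    rw [div_mul_div_cancel₀ this.ne', div_div_div_cancel_right₀ (by positivity)]
  · have := (hI'.mul h1).div hlog hl
    rw [mul_one] at this
    refine this.congr' ?_
    filter_upwards [eventually_gt_atTop 0] with n hn
    have : (0 : ℝ) < n := by exact_mod_cast hn
    have : (0 : ℝ) < (n + 1 : ℕ) := by positivity
    simp only [Pi.div_apply]
    rw [div_mul_div_cancel₀ this.ne', div_div_div_cancel_right₀ (by positivity)]

theorem irrIntegral_cfDen_le (h : GaussExpansion a θ) (N : ℕ) :
    irrIntegral (θ 0) (cfDen a N) ≤ N := by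
  rw [h.irrIntegral_cfDen]
  refine (Finset.sum_le_card_nsmul _ _ 1 fun n _ => ?_).trans (by simp)
  have h1 := h.cfRatio_pos n
  have h2 := h.pos (n + 1)
  have : 0 < cfRatio a n * θ (n + 1) := by positivity
  rw [div_le_one (by positivity)]
  linarith

/-- If the denominators grow superexponentially, then `I_α(t) = o(log t)`. -/
theorem tendsto_irrIntegral_div_log_zero (h : GaussExpansion a θ)
    (hlog : Tendsto (fun n : ℕ => ((n + 1 : ℕ) : ℝ) / Real.log (cfDen a n)) atTop (𝓝 0)) :
    Tendsto (fun t : ℝ => irrIntegral (θ 0) t / Real.log t) atTop (𝓝 0) := by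
  have hlog0 : ∀ n, 0 ≤ Real.log (cfDen a n) := fun n => Real.log_nonneg (h.one_le_cfDen n)
  apply h.tendsto_irrIntegral_div_log
  · have h2 : Tendsto (fun n : ℕ => ((n + 1 + 1 : ℕ) : ℝ) / Real.log (cfDen a (n + 1)))
        atTop (𝓝 0) := (tendsto_add_atTop_iff_nat 1).2 hlog
    refine squeeze_zero (fun n => div_nonneg (irrIntegral_nonneg _ (h.one_le_cfDen n))
      (hlog0 _)) (fun n => ?_) h2
    refine div_le_div_of_nonneg_right ((h.irrIntegral_cfDen_le n).trans ?_) (hlog0 _)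
    exact_mod_cast (by omega : n ≤ n + 1 + 1)
  -- Here `I_α(q_(n+1)) ≤ n + 1` meets `log q_n`: hence the `n + 1` in the hypothesis.
  · exact squeeze_zero (fun n => div_nonneg (irrIntegral_nonneg _ (h.one_le_cfDen _))
      (hlog0 _)) (fun n => div_le_div_of_nonneg_right (h.irrIntegral_cfDen_le _) (hlog0 _)) hlog

end GaussExpansion

/-! ### Comparison with the golden ratio -/

theorem tendsto_average_of_sum_abs_sub_le {u : ℕ → ℝ} {c K : ℝ} {X : ℕ → ℝ}
    (hX : Tendsto (fun n : ℕ => X n / n) atTop (𝓝 0))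
    (hu : ∀ N, ∑ n ∈ Finset.range N, |u n - c| ≤ K * (1 + X N)) :
    Tendsto (fun N : ℕ => (∑ n ∈ Finset.range N, u n) / N) atTop (𝓝 c) := by
  rw [tendsto_iff_norm_sub_tendsto_zero]
  have h1 : Tendsto (fun n : ℕ => K * (1 / (n : ℝ) + X n / n)) atTop (𝓝 0) := by
    simpa using (tendsto_one_div_atTop_nhds_zero_nat.add hX).const_mul K
  refine squeeze_zero' (Eventually.of_forall fun _ => norm_nonneg _) ?_ h1
  filter_upwards [eventually_gt_atTop 0] with N hN
  have hN' : (0 : ℝ) < N := by exact_mod_cast hN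
  have h2 : (∑ n ∈ Finset.range N, u n) / N - c = (∑ n ∈ Finset.range N, (u n - c)) / N := by
    rw [Finset.sum_sub_distrib]
    simp only [Finset.sum_const, Finset.card_range, nsmul_eq_mul]
    field_simp
  rw [h2, Real.norm_eq_abs, abs_div, abs_of_pos hN', div_le_iff₀ hN']
  refine (Finset.abs_sum_le_sum_abs _ _).trans ((hu N).trans_eq ?_)
  field_simp

theorem golden_sq : ((√5 - 1) / 2) ^ 2 = 1 - (√5 - 1) / 2 := by
  have : √5 ^ 2 = 5 := Real.sq_sqrt (by norm_num)
  linear_combination this / 4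

theorem golden_gt : 1 / 2 < (√5 - 1) / 2 := by
  have : (2 : ℝ) < √5 := Real.lt_sqrt_of_sq_lt (by norm_num)
  linarith

theorem golden_lt : (√5 - 1) / 2 < 2 / 3 := by
  have : √5 < 7 / 3 := (Real.sqrt_lt' (by norm_num)).2 (by norm_num)
  linarith

theorem log_golden : -Real.log ((√5 - 1) / 2) = Real.log ((1 + √5) / 2) := by
  rw [← Real.log_inv]
  congr 1
  have : √5 ^ 2 = 5 := Real.sq_sqrt (by norm_num)
  apply inv_eq_of_mul_eq_one_right
  linear_combination this / 4

theorem golden_div : (1 - (√5 - 1) / 2) / (1 + (√5 - 1) / 2 * ((√5 - 1) / 2)) =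
    1 / 2 - √5 / 10 := by
  have : √5 ^ 2 = 5 := Real.sq_sqrt (by norm_num)
  rw [div_eq_iff (by nlinarith [golden_gt])]
  linear_combination (-7 / 40 + √5 / 40) * this

/-- Because `τ (1 + τ) = 1`, a step `x ↦ 1 / (d + x)` shrinks the distance to `τ` by the factor `τ <
2/3`, up to an error from the excess digit `d - 1`. -/
theorem abs_one_div_sub_golden_le {d x : ℝ} (hd : 1 ≤ d) (hx : 0 ≤ x) :
    |1 / (d + x) - (√5 - 1) / 2| ≤ 2 / 3 * (|x - (√5 - 1) / 2| + (d - 1)) := by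
  have h1 := golden_sq
  have h2 := golden_gt
  have h3 := golden_lt
  set τ := (√5 - 1) / 2
  have h4 : 1 / (d + x) - τ = τ * ((τ - x) - (d - 1)) / (d + x) := by
    field_simp
    linear_combination -h1
  rw [h4, abs_div, abs_mul, abs_of_pos (by linarith : 0 < τ), abs_of_pos (by linarith : 0 < d + x)]
  have h5 : |τ - x - (d - 1)| ≤ |x - τ| + (d - 1) := by
    refine (abs_sub _ _).trans ?_
    rw [abs_sub_comm, abs_of_nonneg (by linarith : 0 ≤ d - 1)]
  have h6 : 0 ≤ |x - τ| + (d - 1) := (abs_nonneg _).trans h5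
  calc τ * |τ - x - (d - 1)| / (d + x) ≤ τ * |τ - x - (d - 1)| :=
        div_le_self (by positivity) (by linarith)
    _ ≤ _ := mul_le_mul h3.le h5 (abs_nonneg _) (by norm_num)

theorem abs_log_sub_log_golden_le {x : ℝ} (hx : 1 / 3 ≤ x) :
    |Real.log x - Real.log ((√5 - 1) / 2)| ≤ 3 * |x - (√5 - 1) / 2| := by
  have h2 := golden_gt
  set τ := (√5 - 1) / 2
  have key : ∀ y z : ℝ, 1 / 3 ≤ y → 1 / 3 ≤ z → Real.log y - Real.log z ≤ 3 * |y - z| := by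
    intro y z hy hz
    have hy0 : 0 < y := by linarith
    have hz0 : 0 < z := by linarith
    rw [← Real.log_div hy0.ne' hz0.ne']
    refine (Real.log_le_sub_one_of_pos (by positivity)).trans ?_
    rw [div_sub_one hz0.ne', div_le_iff₀ hz0]
    nlinarith [le_abs_self (y - z), abs_nonneg (y - z)]
  rw [abs_le]
  have := key τ x (by linarith) hx
  rw [abs_sub_comm] at this
  exact ⟨by linarith, key x τ hx (by linarith)⟩

theorem abs_ratio_sub_golden_le {r s : ℝ} (hr : 0 ≤ r) (hs : 0 ≤ s) (hs1 : s ≤ 1) :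
    |(1 - r) / (1 + r * s) - (1 / 2 - √5 / 10)| ≤
      3 * (|r - (√5 - 1) / 2| + |s - (√5 - 1) / 2|) := by
  rw [← golden_div]
  have h1 := golden_sq
  have h2 := golden_gt
  have h3 := golden_lt
  set τ := (√5 - 1) / 2
  have hrs : 0 ≤ r * s := by positivity
  have h4 : (1 - r) / (1 + r * s) - (1 - τ) / (1 + τ * τ) =
      -((r - τ) * (1 + τ * τ + (1 - τ) * s) + (s - τ) * ((1 - τ) * τ)) /
        ((1 + r * s) * (1 + τ * τ)) := by
    field_simp
    ring
  have h5 : 1 ≤ (1 + r * s) * (1 + τ * τ) := by nlinarith [mul_self_nonneg τ]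
  rw [h4, abs_div, abs_neg, abs_of_pos (by linarith : 0 < (1 + r * s) * (1 + τ * τ))]
  refine (div_le_self (abs_nonneg _) h5).trans ((abs_add_le _ _).trans ?_)
  rw [abs_mul, abs_mul, mul_add, mul_comm 3, mul_comm 3]
  have e1 : 0 ≤ (1 - τ) * s := by nlinarith
  have e2 : (1 - τ) * s ≤ 1 := by nlinarith
  gcongr
  · rw [abs_of_nonneg (by nlinarith)]; nlinarith
  · rw [abs_of_nonneg (by nlinarith)]; nlinarith

namespace GaussExpansion

variable {a : ℕ → ℕ} {θ : ℕ → ℝ}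

theorem one_le_digit_cast (h : GaussExpansion a θ) (n : ℕ) : (1 : ℝ) ≤ a n := by
  exact_mod_cast h.one_le_digit n

theorem abs_cfRatio_sub_golden_le_one (h : GaussExpansion a θ) (n : ℕ) :
    |cfRatio a n - (√5 - 1) / 2| ≤ 1 := by
  have h1 := h.cfRatio_pos n
  have h2 := h.cfRatio_le_one n
  have h3 := golden_gt
  have h4 := golden_lt
  rw [abs_le]
  constructor <;> linarith

theorem abs_sub_golden_le_one (h : GaussExpansion a θ) (n : ℕ) :
    |θ n - (√5 - 1) / 2| ≤ 1 := by
  have h1 := h.pos n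
  have h2 := h.lt_one n
  have h3 := golden_gt
  have h4 := golden_lt
  rw [abs_le]
  constructor <;> linarith

theorem sum_abs_cfRatio_sub_golden_le (h : GaussExpansion a θ) (N : ℕ) :
    ∑ n ∈ Finset.range N, |cfRatio a n - (√5 - 1) / 2| ≤
      3 + 2 * ∑ n ∈ Finset.range N, ((a n : ℝ) - 1) := by
  -- The extra term carries the induction: `3 = 1 / (1 - 2/3)`, so a new error counted three times
  -- costs at most twice the previous error plus `2 (a (N + 1) - 1)`.
  have key : ∀ N, ∑ n ∈ Finset.range N, |cfRatio a n - (√5 - 1) / 2| +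
      3 * |cfRatio a N - (√5 - 1) / 2| ≤ 3 + 2 * ∑ n ∈ Finset.range (N + 1), ((a n : ℝ) - 1) := by
    intro N
    induction N with
    | zero =>
      have := h.abs_cfRatio_sub_golden_le_one 0
      have := h.one_le_digit_cast 0
      simp only [Finset.sum_range_zero, Finset.sum_range_succ, zero_add]
      linarith
    | succ N ih =>
      have h1 := abs_one_div_sub_golden_le (h.one_le_digit_cast (N + 1)) (h.cfRatio_pos N).le
      rw [← h.cfRatio_succ] at h1
      have := h.one_le_digit_cast (N + 1)
      rw [Finset.sum_range_succ, Finset.sum_range_succ _ (N + 1)]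
      linarith
  cases N with
  | zero => simp
  | succ N =>
    have := key N
    rw [Finset.sum_range_succ]
    linarith [abs_nonneg (cfRatio a N - (√5 - 1) / 2)]

/-- Here the contraction runs from `θ (n + 1)` to `θ n`, so it is summed over `n` at once: up to
boundary terms bounded by 1, the sum `S` satisfies `S ≤ 2/3 (S + X) + 1`, with `X` the total digit
excess. -/
theorem sum_abs_sub_golden_le (h : GaussExpansion a θ) (N : ℕ) :
    ∑ n ∈ Finset.range N, |θ (n + 1) - (√5 - 1) / 2| ≤
      3 + 2 * ∑ n ∈ Finset.range N, ((a n : ℝ) - 1) := by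
  have h1 : ∀ n, |θ n - (√5 - 1) / 2| ≤
      2 / 3 * (|θ (n + 1) - (√5 - 1) / 2| + ((a n : ℝ) - 1)) := by
    intro n
    have := abs_one_div_sub_golden_le (h.one_le_digit_cast n) (h.pos (n + 1)).le
    have hpos : 0 < (a n : ℝ) + θ (n + 1) := by
      have := h.pos (n + 1); positivity
    rwa [← (eq_div_iff hpos.ne').2 (h.mul_eq n)] at this
  have h2 := Finset.sum_le_sum fun n (_ : n ∈ Finset.range N) => h1 n
  rw [← Finset.mul_sum, Finset.sum_add_distrib] at h2
  have h3 := Finset.sum_range_succ' (fun n => |θ n - (√5 - 1) / 2|) N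
  rw [Finset.sum_range_succ] at h3
  have h4 := h.abs_sub_golden_le_one N
  have h5 := h.abs_sub_golden_le_one 0
  linarith [abs_nonneg (θ 0 - (√5 - 1) / 2)]

/-- Digits at most 2 keep the ratios away from 0, where `log` would fail to be Lipschitz. -/
theorem third_le_cfRatio (h : GaussExpansion a θ) (ha : ∀ n, a n ≤ 2) (n : ℕ) :
    1 / 3 ≤ cfRatio a n := by
  have ha' : ∀ n, (a n : ℝ) ≤ 2 := fun n => by exact_mod_cast ha n
  cases n with
  | zero =>
    simp only [cfRatio, cfDen, Int.cast_one, Int.cast_natCast]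
    exact one_div_le_one_div_of_le (by linarith [h.one_le_digit_cast 0]) (by linarith [ha' 0])
  | succ n =>
    rw [h.cfRatio_succ]
    have := h.cfRatio_pos n
    exact one_div_le_one_div_of_le (by positivity)
      (by linarith [ha' (n + 1), h.cfRatio_le_one n])

/-- If the partial quotients are `1` or `2` and those equal to `2` have density zero, then
`I_α(t) / log t` has the same limit as for the golden ratio. -/
theorem tendsto_irrIntegral_div_log_golden (h : GaussExpansion a θ) (ha : ∀ n, a n ≤ 2)
    (hX : Tendsto (fun N : ℕ => (∑ n ∈ Finset.range N, ((a n : ℝ) - 1)) / N) atTop (𝓝 0)) :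
    Tendsto (fun t : ℝ => irrIntegral (θ 0) t / Real.log t) atTop
      (𝓝 ((1 / 2 - √5 / 10) / Real.log ((1 + √5) / 2))) := by
  have hX0 : ∀ N, 0 ≤ ∑ n ∈ Finset.range N, ((a n : ℝ) - 1) := fun N =>
    Finset.sum_nonneg fun n _ => by linarith [h.one_le_digit_cast n]
  have hl : Real.log ((1 + √5) / 2) ≠ 0 := (Real.log_pos (by linarith [golden_gt])).ne'
  apply h.tendsto_irrIntegral_div_log_of_tendsto_div hl
  · simp only [h.irrIntegral_cfDen]
    refine tendsto_average_of_sum_abs_sub_le (K := 18) hX fun N => ?_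
    refine (Finset.sum_le_sum fun n _ => abs_ratio_sub_golden_le (h.cfRatio_pos n).le
      (h.pos (n + 1)).le (h.lt_one (n + 1)).le).trans ?_
    rw [← Finset.mul_sum, Finset.sum_add_distrib]
    linarith [h.sum_abs_cfRatio_sub_golden_le N, h.sum_abs_sub_golden_le N, hX0 N]
  · simp only [h.log_cfDen, ← log_golden]
    refine tendsto_average_of_sum_abs_sub_le (K := 9) hX fun N => ?_
    refine (Finset.sum_le_sum fun n _ => ?_).trans (b := ∑ n ∈ Finset.range N,
      3 * |cfRatio a n - (√5 - 1) / 2|) ?_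
    · rw [neg_sub_neg, abs_sub_comm]
      exact abs_log_sub_log_golden_le (h.third_le_cfRatio ha n)
    · rw [← Finset.mul_sum]
      linarith [h.sum_abs_cfRatio_sub_golden_le N, hX0 N]

end GaussExpansion

theorem gaussExpansion_golden : GaussExpansion (fun _ => 1) (fun _ => (√5 - 1) / 2) where
  pos _ := by linarith [golden_gt]
  lt_one _ := by linarith [golden_lt]
  mul_eq _ := by
    push_cast
    linear_combination golden_sq

theorem tendsto_irrIntegral_golden :
    Tendsto (fun t : ℝ => irrIntegral ((√5 - 1) / 2) t / Real.log t) atTop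
      (𝓝 ((1 / 2 - √5 / 10) / Real.log ((1 + √5) / 2))) :=
  gaussExpansion_golden.tendsto_irrIntegral_div_log_golden (fun _ => by norm_num) (by simp)

theorem tendsto_sub_atTop_of_tendsto_div_log {f g : ℝ → ℝ} {a b : ℝ} (hab : b < a)
    (hf : Tendsto (fun t => f t / Real.log t) atTop (𝓝 a))
    (hg : Tendsto (fun t => g t / Real.log t) atTop (𝓝 b)) :
    Tendsto (fun t => f t - g t) atTop atTop := by
  refine ((hf.sub hg).pos_mul_atTop (sub_pos.2 hab) Real.tendsto_log_atTop).congr' ?_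
  filter_upwards [eventually_gt_atTop 1] with t ht
  have := (Real.log_pos ht).ne'
  field_simp

/-! ### Prescribed digits and transcendence by counting -/

/-- Compactness of `[0,1]^ℕ`: the sequences satisfying the first `N` relations form nested nonempty
closed sets, and a point of their intersection satisfies all relations. The strict bounds then
follow from the relations. -/
theorem exists_gaussExpansion {a : ℕ → ℕ} (ha : ∀ n, 1 ≤ a n) : ∃ θ, GaussExpansion a θ := by
  have hne : ∀ (N : ℕ) (b : ℕ → ℕ), (∀ n, 1 ≤ b n) → ∃ θ : ℕ → ℝ,
      (∀ n, θ n ∈ Set.Icc (0 : ℝ) 1) ∧ ∀ n < N, θ n * (b n + θ (n + 1)) = 1 := by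
    intro N
    induction N with
    | zero => exact fun b _ => ⟨fun _ => 0, fun _ => by simp, by simp⟩
    | succ N ih =>
      intro b hb
      obtain ⟨θ, h1, h2⟩ := ih (fun n => b (n + 1)) fun n => hb (n + 1)
      have hb0 : (1 : ℝ) ≤ b 0 := by exact_mod_cast hb 0
      have h0 := (h1 0).1
      have hpos : 0 < (b 0 : ℝ) + θ 0 := by linarith
      refine ⟨fun n => Nat.casesOn n (1 / (b 0 + θ 0)) θ, ?_, ?_⟩
      · rintro (_ | n)
        · exact ⟨(one_div_pos.2 hpos).le, (div_le_one hpos).2 (by linarith)⟩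
        · exact h1 n
      · rintro (_ | n) hn
        · exact one_div_mul_cancel hpos.ne'
        · exact h2 n (by omega)
  let C : ℕ → Set (ℕ → ℝ) := fun N =>
    {θ | (∀ n, θ n ∈ Set.Icc (0 : ℝ) 1) ∧ ∀ n < N, θ n * (a n + θ (n + 1)) = 1}
  have hcl : ∀ N, IsClosed (C N) := by
    intro N
    have : C N = (⋂ n, {θ : ℕ → ℝ | θ n ∈ Set.Icc (0 : ℝ) 1}) ∩
        ⋂ n, ⋂ _ : n < N, {θ : ℕ → ℝ | θ n * (a n + θ (n + 1)) = 1} := by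
      ext θ
      simp [C]
    rw [this]
    exact (isClosed_iInter fun n => isClosed_Icc.preimage (continuous_apply n)).inter
      (isClosed_iInter fun n => isClosed_iInter fun _ =>
        isClosed_eq (by fun_prop) continuous_const)
  have hcpt : IsCompact (C 0) := by
    refine (isCompact_univ_pi fun _ : ℕ => isCompact_Icc (a := (0 : ℝ)) (b := 1)).of_isClosed_subset
      (hcl 0) fun θ hθ => ?_
    exact fun n _ => hθ.1 n
  obtain ⟨θ, hθ⟩ := IsCompact.nonempty_iInter_of_sequence_nonempty_isCompact_isClosed C
    (fun N θ h => ⟨h.1, fun n hn => h.2 n (by omega)⟩) (fun N => hne N a ha) hcpt hcl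
  rw [Set.mem_iInter] at hθ
  have h1 := (hθ 0).1
  have h2 : ∀ n, θ n * (a n + θ (n + 1)) = 1 := fun n => (hθ (n + 1)).2 n (by omega)
  have hpos : ∀ n, 0 < θ n := fun n =>
    (h1 n).1.lt_of_ne' fun h0 => by simpa [h0] using h2 n
  refine ⟨θ, hpos, fun n => (h1 n).2.lt_of_ne fun h0 => ?_, h2⟩
  have h3 := h2 n
  have h4 : (1 : ℝ) ≤ a n := by exact_mod_cast ha n
  rw [h0] at h3
  linarith [hpos (n + 1)]

/-- A number determines its partial quotients. -/
theorem GaussExpansion.digit_unique {a b : ℕ → ℕ} {θ η : ℕ → ℝ} (h : GaussExpansion a θ)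
    (h' : GaussExpansion b η) (h0 : θ 0 = η 0) : a = b := by
  have step : ∀ n, θ n = η n → a n = b n ∧ θ (n + 1) = η (n + 1) := by
    intro n hn
    have e : (a n : ℝ) + θ (n + 1) = b n + η (n + 1) := by
      have h1 := h.mul_eq n
      rw [← h'.mul_eq n, hn] at h1
      exact mul_left_cancel₀ (h'.pos n).ne' h1
    have hab : a n = b n := by
      have h1 := h.pos (n + 1)
      have h2 := h.lt_one (n + 1)
      have h3 := h'.pos (n + 1)
      have h4 := h'.lt_one (n + 1)
      apply le_antisymm <;> apply Nat.le_of_lt_succ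
      · exact_mod_cast (by push_cast; linarith : (a n : ℝ) < (b n + 1 : ℕ))
      · exact_mod_cast (by push_cast; linarith : (b n : ℝ) < (a n + 1 : ℕ))
    rw [hab] at e
    exact ⟨hab, add_left_cancel e⟩
  have hθ : ∀ n, θ n = η n := fun n => Nat.rec h0 (fun n ih => (step n ih).2) n
  exact funext fun n => (step n (hθ n)).1

/-- Distinct sets `S` give distinct digits, hence distinct numbers, and there are uncountably many
`S` but only countably many reals algebraic over `R`. A general `R` allows use over `ℚ` and then
over `ℚ[β]`. -/
theorem exists_gaussExpansion_transcendental (R : Type*) [CommRing R] [IsDomain R] [Countable R]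
    [Algebra R ℝ] [Module.IsTorsionFree R ℝ] {A : Set ℕ → ℕ → ℕ} (hA : Function.Injective A)
    (hA1 : ∀ S n, 1 ≤ A S n) :
    ∃ S θ, GaussExpansion (A S) θ ∧ Transcendental R (θ 0) := by
  choose θ hθ using fun S => exists_gaussExpansion (hA1 S)
  have hinj : Function.Injective fun S => θ S 0 := fun S T hST =>
    hA ((hθ S).digit_unique (hθ T) hST)
  by_contra! hcon
  have halg : ∀ S, IsAlgebraic R (θ S 0) := fun S => not_not.1 (hcon S (θ S) (hθ S))
  have : Countable {x : ℝ | IsAlgebraic R x} := (Algebraic.countable R ℝ).to_subtype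
  have : Countable (Set ℕ) := Function.Injective.countable
    (f := fun S => (⟨θ S 0, halg S⟩ : {x : ℝ | IsAlgebraic R x}))
    fun S T hST => hinj (congrArg Subtype.val hST)
  obtain ⟨f, hf⟩ := exists_surjective_nat (Set ℕ)
  exact Function.cantor_surjective f hf

/-! ### The two families of digits -/

open Classical in
/-- Partial quotients `1`, with a `2` at the squares of the elements of `S`. -/
noncomputable def sparseDigits (S : Set ℕ) (n : ℕ) : ℕ := if ∃ k ∈ S, n = k * k then 2 else 1

theorem sparseDigits_injective : Function.Injective sparseDigits := by
  have key : ∀ S k, k ∈ S ↔ sparseDigits S (k * k) = 2 := by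
    intro S k
    have : (∃ j ∈ S, k * k = j * j) ↔ k ∈ S :=
      ⟨fun ⟨j, hj, h⟩ => by rwa [Nat.mul_self_inj.1 h], fun h => ⟨k, h, rfl⟩⟩
    simp [sparseDigits, this]
  intro S T h
  ext k
  rw [key, key, h]

theorem sparseDigits_le (S : Set ℕ) (n : ℕ) : sparseDigits S n ≤ 2 := by
  unfold sparseDigits; split_ifs <;> norm_num

theorem one_le_sparseDigits (S : Set ℕ) (n : ℕ) : 1 ≤ sparseDigits S n := by
  unfold sparseDigits; split_ifs <;> norm_num

/-- The sum counts digits 2, which sit only at perfect squares. -/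
theorem sum_sparseDigits_sub_one_le (S : Set ℕ) (N : ℕ) :
    ∑ n ∈ Finset.range N, ((sparseDigits S n : ℝ) - 1) ≤ √N + 1 := by
  classical
  have h1 : ∑ n ∈ Finset.range N, ((sparseDigits S n : ℝ) - 1) =
      ((Finset.range N).filter fun n => ∃ k ∈ S, n = k * k).card := by
    rw [Finset.card_filter, Nat.cast_sum]
    refine Finset.sum_congr rfl fun n _ => ?_
    unfold sparseDigits
    split_ifs <;> norm_num
  have h2 : ((Finset.range N).filter fun n => ∃ k ∈ S, n = k * k) ⊆
      (Finset.range (Nat.sqrt N + 1)).image fun k => k * k := by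
    intro n hn
    simp only [Finset.mem_filter, Finset.mem_range, Finset.mem_image] at hn ⊢
    obtain ⟨hn, k, -, rfl⟩ := hn
    exact ⟨k, Nat.lt_succ_of_le (Nat.le_sqrt.2 hn.le), rfl⟩
  have h3 := (Finset.card_le_card h2).trans Finset.card_image_le
  rw [Finset.card_range] at h3
  rw [h1]
  calc _ ≤ ((Nat.sqrt N + 1 : ℕ) : ℝ) := by exact_mod_cast h3
    _ ≤ _ := by push_cast; gcongr; exact Real.nat_sqrt_le_real_sqrt

theorem tendsto_average_sparseDigits_sub_one (S : Set ℕ) :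
    Tendsto (fun N : ℕ => (∑ n ∈ Finset.range N, ((sparseDigits S n : ℝ) - 1)) / N)
      atTop (𝓝 0) := by
  have h1 : Tendsto (fun N : ℕ => (√(N : ℝ))⁻¹ + 1 / (N : ℝ)) atTop (𝓝 0) := by
    simpa using ((Real.tendsto_sqrt_atTop.comp
      tendsto_natCast_atTop_atTop).inv_tendsto_atTop).add tendsto_one_div_atTop_nhds_zero_nat
  refine squeeze_zero (fun N => div_nonneg (Finset.sum_nonneg fun n _ => ?_) N.cast_nonneg)
    (fun N => ?_) h1
  · have : (1 : ℝ) ≤ sparseDigits S n := by exact_mod_cast one_le_sparseDigits S n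
    linarith
  · refine (div_le_div_of_nonneg_right (sum_sparseDigits_sub_one_le S N) N.cast_nonneg).trans_eq ?_
    rw [add_div, Real.sqrt_div_self', one_div]

open Classical in
/-- Rapidly growing partial quotients. -/
noncomputable def rapidDigits (S : Set ℕ) (n : ℕ) : ℕ := 2 ^ (2 * n + 1) + if n ∈ S then 1 else 0

theorem rapidDigits_injective : Function.Injective rapidDigits := by
  have key : ∀ S k, k ∈ S ↔ rapidDigits S k = 2 ^ (2 * k + 1) + 1 := by
    intro S k
    by_cases h : k ∈ S <;> simp [rapidDigits, h]
  intro S T h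
  ext k
  rw [key, key, h]

theorem one_le_rapidDigits (S : Set ℕ) (n : ℕ) : 1 ≤ rapidDigits S n :=
  Nat.one_le_two_pow.trans (Nat.le_add_right _ _)

/-- The exponents `2 n + 1` of the digits add up to squares: `n² + (2 n + 1) = (n + 1)²`. -/
theorem two_pow_le_cfDen_rapidDigits {S : Set ℕ} {θ : ℕ → ℝ}
    (h : GaussExpansion (rapidDigits S) θ) (n : ℕ) :
    2 ^ (n * n) ≤ cfDen (rapidDigits S) n := by
  have hd : ∀ n, (2 : ℤ) ^ (2 * n + 1) ≤ rapidDigits S n := fun n => by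
    exact_mod_cast (Nat.le_add_right _ _ : 2 ^ (2 * n + 1) ≤ rapidDigits S n)
  induction n with
  | zero => simp [cfDen]
  | succ n ih =>
    have h1 : (rapidDigits S n : ℤ) * cfDen (rapidDigits S) n ≤ cfDen (rapidDigits S) (n + 1) := by
      cases n with
      | zero => simp [cfDen]
      | succ n =>
        have := h.cfDen_pos n
        simp only [cfDen]
        linarith
    calc (2 : ℤ) ^ ((n + 1) * (n + 1)) = 2 ^ (2 * n + 1) * 2 ^ (n * n) := by ring
      _ ≤ rapidDigits S n * cfDen (rapidDigits S) n := by
          gcongr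
          exact hd n
      _ ≤ _ := h1

theorem GaussExpansion.tendsto_irrIntegral_div_log_rapidDigits {S : Set ℕ} {θ : ℕ → ℝ}
    (h : GaussExpansion (rapidDigits S) θ) :
    Tendsto (fun t : ℝ => irrIntegral (θ 0) t / Real.log t) atTop (𝓝 0) := by
  apply h.tendsto_irrIntegral_div_log_zero
  have h1 : Tendsto (fun n : ℕ => 2 / Real.log 2 * (1 / (n : ℝ))) atTop (𝓝 0) := by
    simpa using tendsto_one_div_atTop_nhds_zero_nat.const_mul (2 / Real.log 2)
  refine squeeze_zero' (Eventually.of_forall fun n => div_nonneg (Nat.cast_nonneg _)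
    (Real.log_nonneg (h.one_le_cfDen n))) ?_ h1
  filter_upwards [eventually_gt_atTop 0] with n hn
  have hn' : (1 : ℝ) ≤ n := by exact_mod_cast hn
  have hlog2 : 0 < Real.log 2 := Real.log_pos (by norm_num)
  have h2 : n * n * Real.log 2 ≤ Real.log (cfDen (rapidDigits S) n) := by
    have h3 : ((2 : ℝ) ^ (n * n)) ≤ cfDen (rapidDigits S) n := by
      exact_mod_cast two_pow_le_cfDen_rapidDigits h n
    have h4 := Real.log_le_log (by positivity) h3
    rw [Real.log_pow] at h4
    exact_mod_cast h4
  calc ((n + 1 : ℕ) : ℝ) / Real.log (cfDen (rapidDigits S) n)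
      ≤ (2 * n) / (n * n * Real.log 2) := by
        gcongr
        push_cast
        linarith
    _ = 2 / Real.log 2 * (1 / (n : ℝ)) := by field_simp

/-! ### Algebraic independence and conclusion -/

theorem algebraicIndependent_pair {x y : ℝ} (hy : Transcendental ℚ y)
    (hx : Transcendental (Algebra.adjoin ℚ {y}) x) : AlgebraicIndependent ℚ ![x, y] := by
  rw [AlgebraicIndependent.iff_transcendental_adjoin_image 0]
  constructor
  · have : Subsingleton {j : Fin 2 // j ≠ 0} := ⟨by decide⟩
    rw [algebraicIndependent_singleton_iff ⟨1, by decide⟩]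
    exact hy
  · have : ![x, y] '' {0}ᶜ = {y} := by
      ext z
      simp [Fin.exists_fin_two, eq_comm]
    rw [this]
    exact hx

/-- Equality would put `x` in `ℚ[y]`. The cases `m = ±1` give `α ± β ∉ ℤ`. -/
theorem AlgebraicIndependent.add_intCast_mul_ne_intCast {x y : ℝ}
    (h : AlgebraicIndependent ℚ ![x, y]) (m n : ℤ) : x + m * y ≠ n := by
  intro hxy
  have hx := h.transcendental_adjoin (s := {1}) (i := 0) (by decide)
  have hy : y ∈ Algebra.adjoin ℚ (![x, y] '' {1}) := Algebra.subset_adjoin ⟨1, rfl, rfl⟩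
  have hmem : x ∈ Algebra.adjoin ℚ (![x, y] '' {1}) := by
    have := sub_mem (intCast_mem _ n) (mul_mem (intCast_mem _ m) hy)
    rwa [← eq_sub_of_add_eq hxy] at this
  exact hx (isAlgebraic_algebraMap (⟨x, hmem⟩ : Algebra.adjoin ℚ (![x, y] '' {1})))

theorem countable_adjoin_singleton (y : ℝ) : Countable (Algebra.adjoin ℚ {y}) := by
  have : Countable (Polynomial ℚ) :=
    Cardinal.mk_le_aleph0_iff.1 (Polynomial.cardinalMk_le_max.trans (by simp))
  rw [Algebra.adjoin_singleton_eq_range_aeval]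
  exact (Set.countable_range (Polynomial.aeval (R := ℚ) y)).to_subtype

theorem exists_algebraicIndependent_limits : ∃ α β : ℝ, AlgebraicIndependent ℚ ![α, β] ∧
    Tendsto (fun t : ℝ => irrIntegral α t / Real.log t) atTop
      (𝓝 ((1 / 2 - √5 / 10) / Real.log ((1 + √5) / 2))) ∧
    Tendsto (fun t : ℝ => irrIntegral β t / Real.log t) atTop (𝓝 0) := by
  obtain ⟨S, η, hη, hβ⟩ :=
    exists_gaussExpansion_transcendental ℚ rapidDigits_injective one_le_rapidDigits
  have := countable_adjoin_singleton (η 0)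
  obtain ⟨T, θ, hθ, hα⟩ := exists_gaussExpansion_transcendental (Algebra.adjoin ℚ {η 0})
    sparseDigits_injective one_le_sparseDigits
  exact ⟨θ 0, η 0, algebraicIndependent_pair hβ hα,
    hθ.tendsto_irrIntegral_div_log_golden (sparseDigits_le T)
      (tendsto_average_sparseDigits_sub_one T),
    hη.tendsto_irrIntegral_div_log_rapidDigits⟩

theorem not_changesSignInfinitelyOften_of_tendsto_atTop {f : ℝ → ℝ} (hf : Tendsto f atTop atTop) :
    ¬ ChangesSignInfinitelyOften f := fun h =>
  h.2 ((hf.eventually_ge_atTop 0).mono fun _ => not_lt.2)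

theorem mainTheorem5 :
    Tendsto (fun t : ℝ => irrIntegral ((√5 - 1) / 2) t / Real.log t) atTop
      (𝓝 ((1 / 2 - √5 / 10) / Real.log ((1 + √5) / 2))) ∧
    (∀ α β a b : ℝ, Irrational α → Irrational β →
      Tendsto (fun t : ℝ => irrIntegral α t / Real.log t) atTop (𝓝 a) →
      Tendsto (fun t : ℝ => irrIntegral β t / Real.log t) atTop (𝓝 b) →
      b < a →
      Tendsto (fun t : ℝ => irrIntegral α t - irrIntegral β t) atTop atTop) ∧
    (∃ α β a b : ℝ, AlgebraicIndependent ℚ ![α, β] ∧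
      Tendsto (fun t : ℝ => irrIntegral α t / Real.log t) atTop (𝓝 a) ∧
      Tendsto (fun t : ℝ => irrIntegral β t / Real.log t) atTop (𝓝 b) ∧
      a ≠ b ∧
      Tendsto (fun t : ℝ => irrIntegral α t - irrIntegral β t) atTop atTop ∧
      ¬ ChangesSignInfinitelyOften (fun t : ℝ => irrIntegral α t - irrIntegral β t)) ∧
    ¬ (∀ α β : ℝ, Irrational α → Irrational β →
      (∀ n : ℤ, α + β ≠ n) → (∀ n : ℤ, α - β ≠ n) →
      ChangesSignInfinitelyOften (fun t : ℝ => irrIntegral α t - irrIntegral β t)) := by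
  obtain ⟨α, β, hind, hα, hβ⟩ := exists_algebraicIndependent_limits
  have hpos : 0 < (1 / 2 - √5 / 10) / Real.log ((1 + √5) / 2) :=
    div_pos (by linarith [golden_lt]) (Real.log_pos (by linarith [golden_gt]))
  have hlim := tendsto_sub_atTop_of_tendsto_div_log hpos hα hβ
  have hsign := not_changesSignInfinitelyOften_of_tendsto_atTop hlim
  refine ⟨tendsto_irrIntegral_golden,
    fun _ _ _ _ _ _ ha hb hab => tendsto_sub_atTop_of_tendsto_div_log hab ha hb,
    ⟨α, β, _, _, hind, hα, hβ, hpos.ne', hlim, hsign⟩,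
    fun hall => hsign (hall α β (hind.transcendental 0).irrational
      (hind.transcendental 1).irrational (fun n => ?_) (fun n => ?_))⟩
  · simpa using hind.add_intCast_mul_ne_intCast 1 n
  · simpa [sub_eq_add_neg] using hind.add_intCast_mul_ne_intCast (-1) n
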